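/- **Setting.** All sequences and polynomials are over $GF(2)$. Let $R_1,R_2$ be maximal-length LFSRs of lengths $L_1,L_2\ge 1$, i.e. linear recurrences of orders $L_1,L_2$ whose characteristic polynomials $P_1,P_2$ are primitive. Let $(a_i)_{i\ge0}$ be a nonzero output sequence of $R_1$, let $(b_i)_{i\ge0}$ be an output sequence of $R_2$, and let $\alpha$ be a root of $P_2$ in an extension field of $GF(2)$. *Generators.* The shrunken sequence of $(a,b)$ is the sequence of those $b_i$ with $a_i=1$, in order. For a number $w\ge 0$ of selected cells $i_0,\dots,i_{w-1}\in\{0,\dots,L_1-1\}$ put $X_t=1+\sum_{j<w}2^{j}a_{t+i_j}$ (the cells of $R_1$ at time $t$ contain $a_t,\dots,a_{t+L_1-1}$) and $b'_t=b_{X_0+\dots+X_{t-1}}$; the output of the clock-controlled shrinking generator (CCSG) is the shrunken sequence of $(a,b')$. *Cellular automata.* A binary string $s_1\cdots s_n$ codes the null-boundary hybrid cellular automaton (CA) on $n$ cells with $x_i^{t+1}=x_{i-1}^t+s_ix_i^t+x_{i+1}^t$ and $x_0=x_{n+1}=0$ (bit $0$ = rule 90, bit $1$ = rule 150). Its characteristic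 polynomial is that of its transition matrix. For irreducible $Q$, the Cattell–Muzio CA of $Q$ are the 90/150 null-boundary CA with characteristic polynomial $Q$. **Theorem.** Let either $c$ be the shrunken sequence of $(a,b)$ and $M=E:=2^0+2^1+\dots+2^{L_1-1}$, or $c$ be the output sequence of a CCSG as above and $M=D:=(1+2^w)2^{L_1-1}-1$. 1. The product $P(x)=\prod_{i=0}^{L_2-1}\bigl(x+\alpha^{2^iM}\bigr)$ has its coefficients in $GF(2)$ and has degree $L_2$. It is irreducible whenever $\gcd(M,2^{L_2}-1)=1$. 2. If $P$ is irreducible, there are precisely two 90/150 null-boundary CA with characteristic polynomial $P$, and their strings are the reversals of each other (they are distinct if $L_2\ge2$, and coincide if $L_2=1$). 3. Suppose $P$ is irreducible. To either of these two strings apply $L_1-1$ times the operation "complement the least significant (last) bit, then concatenate the result with its mirror image". The resulting string has length $L_2\,2^{L_1-1}$, the CA it codes has characteristic polynomial $P(x)^{2^{L_1-1}}$, and for every cell of this CA there is an initial state from which that cell produces exactly the sequence $c$. In particular $c$ is among the output sequences of both of these linear CA. -/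

import Mathlib

open Polynomial

/-- A linear feedback shift register over `GF(2)`, given by its linear recurrence (whose order is
the length of the register), has maximal length if its characteristic polynomial is primitive:
irreducible, with roots of multiplicative order `2 ^ L - 1`. Its nonzero output sequences are then
the PN-sequences. -/
def IsMaximalLength (R : LinearRecurrence (ZMod 2)) : Prop :=
  Irreducible R.charPoly ∧ orderOf (AdjoinRoot.root R.charPoly) = 2 ^ R.order - 1

/-- The shrunken sequence: the terms `b i` with `a i = 1`, in order; `b i` is discarded when
`a i = 0`. -/
noncomputable def shrunken (a b : ℕ → ZMod 2) : ℕ → ZMod 2 :=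
  fun j => b (Nat.nth (fun i => a i = 1) j)

/-- The decimation function `X_t = 1 + ∑ j < w, 2 ^ j * A_{i_j}(t)`. The cells of the control
register at time `t` hold `A_k(t) = a (t + k)`, `0 ≤ k < L`. -/
def decimation {L w : ℕ} (a : ℕ → ZMod 2) (i : Fin w → Fin L) (t : ℕ) : ℕ :=
  1 + ∑ j : Fin w, 2 ^ (j : ℕ) * (a (t + (i j : ℕ))).val

/-- The output of the clock-controlled shrinking generator: after producing the term at time `t`
the second register is clocked `X_t` times, which gives `b' t = b (X_0 + ⋯ + X_{t-1})`; then `b'`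
is shrunk by `a`. -/
noncomputable def ccsg {L w : ℕ} (a b : ℕ → ZMod 2) (i : Fin w → Fin L) : ℕ → ZMod 2 :=
  shrunken a (fun t => b (∑ u ∈ Finset.range t, decimation a i u))

/-- One step of the null-boundary hybrid cellular automaton coded by the binary string `s`, where
the bit `0` stands for rule 90 (left neighbour + right neighbour) and the bit `1` for rule 150
(left neighbour + cell + right neighbour). -/
def caStep (s : List (ZMod 2)) (x : Fin s.length → ZMod 2) : Fin s.length → ZMod 2 := fun i =>
  (if 0 < (i : ℕ) then x ⟨(i : ℕ) - 1, by have := i.isLt; omega⟩ else 0)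
    + (if s.get i = 1 then x i else 0)
    + (if h : (i : ℕ) + 1 < s.length then x ⟨(i : ℕ) + 1, h⟩ else 0)

/-- The transition matrix of the cellular automaton coded by `s`. -/
def caMatrix (s : List (ZMod 2)) : Matrix (Fin s.length) (Fin s.length) (ZMod 2) :=
  Matrix.of fun i j =>
    if i = j then s.get i else if (i : ℕ) + 1 = j ∨ (j : ℕ) + 1 = i then 1 else 0

/-- The matrix `caMatrix s` is the matrix of the linear map `caStep s`. -/
theorem caMatrix_mulVec (s : List (ZMod 2)) (x : Fin s.length → ZMod 2) :
    (caMatrix s).mulVec x = caStep s x := by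
  funext i
  have hs : s.get i = 0 ∨ s.get i = 1 := by
    generalize s.get i = y
    revert y
    decide
  have key : ∀ j : Fin s.length, caMatrix s i j * x j =
      (if (j : ℕ) + 1 = i then x j else 0) + (if j = i then s.get i * x j else 0)
        + (if (i : ℕ) + 1 = j then x j else 0) := by
    intro j
    by_cases h1 : j = i
    · subst h1
      simp [caMatrix]
    · have h1' : ¬ i = j := fun h => h1 h.symm
      by_cases h2 : (j : ℕ) + 1 = i
      · have h3 : ¬ (i : ℕ) + 1 = j := by omega
        simp [caMatrix, h1, h1', h2, h3]
      · by_cases h3 : (i : ℕ) + 1 = j <;> simp [caMatrix, h1, h1', h2, h3]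
  simp only [Matrix.mulVec, dotProduct, key, Finset.sum_add_distrib, caStep]
  congr 1
  · congr 1
    · by_cases h : 0 < (i : ℕ)
      · rw [if_pos h, Finset.sum_eq_single ⟨(i : ℕ) - 1, by have := i.isLt; omega⟩]
        · rw [if_pos]
          simp only
          omega
        · intro j _ hj
          rw [if_neg]
          intro h'
          apply hj
          ext
          simp only
          omega
        · simp
      · rw [if_neg h]
        apply Finset.sum_eq_zero
        intro j _
        rw [if_neg]
        omega
    · rcases hs with h | h <;> rw [h] <;> simp
  · by_cases h : (i : ℕ) + 1 < s.length
    · rw [dif_pos h, Finset.sum_eq_single ⟨(i : ℕ) + 1, h⟩]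
      · simp
      · intro j _ hj
        rw [if_neg]
        intro h'
        apply hj
        ext
        simp only
        omega
      · simp
    · rw [dif_neg h]
      apply Finset.sum_eq_zero
      intro j _
      rw [if_neg]
      have := j.isLt
      omega

/-- The strings `s₁` and `s₂` code the Cattell–Muzio cellular automata of `Q`: they are precisely
the null-boundary 90/150 automata whose characteristic polynomial is `Q`, and they are reversals of
each other. -/
def IsCattellMuzioPair (Q : (ZMod 2)[X]) (s₁ s₂ : List (ZMod 2)) : Prop :=
  (∀ t : List (ZMod 2), (caMatrix t).charpoly = Q ↔ t = s₁ ∨ t = s₂) ∧ s₂ = s₁.reverse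

/-- Complement the least significant (that is, last) bit of a binary string. -/
def complementLast (s : List (ZMod 2)) : List (ZMod 2) :=
  s.modify (s.length - 1) (fun y => y + 1)

/-- Complement the least significant bit, then concatenate with the mirror image. -/
def doubling (s : List (ZMod 2)) : List (ZMod 2) :=
  complementLast s ++ (complementLast s).reverse

/-! The characteristic polynomial of a 90/150 automaton is the continuant `p` of its string, and the
string is the list of quotients in Euclid's algorithm for `p` and the continuant `q` of the string
without its first bit. Since `X ^ 2 + X` is unchanged under `X ↦ X + 1`, all such pairs satisfy one
differential relation `ContRel`, and this relation (with `deg q < deg p`) characterizes them.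

Modulo `p` the relation becomes a quadratic congruence for `q`. For irreducible `p` it has at most
two roots, and `det_contMat` shows that they belong to the string and to its reversal. Existence is
solved in `GF(2)[X]/(P)`: rescaling gives an Artin–Schreier equation, solvable by additive Hilbert
90 because Euler's formula makes the relevant trace vanish. The solution lifts to an exact solution
of `ContRel` because the defect is a square divisible by `P`, hence by `P ^ 2`, and its degree is
too small (`contRel_of_dvd`).

Doubling a string squares its continuant and keeps the continuants of proper prefixes coprime to
`P`. The state of cell `k` is the prefix continuant of length `k`, evaluated at the transition map
and read at the first cell. Coprimality thus makes initial states inject into the outputs of cell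
`k`, and a dimension count yields every solution of the recurrence (`exists_initial_state`).

Finally, both generators read `b` at positions that advance by `M` whenever the index advances by `2
^ (L₁ - 1)`. Since `P ^ 2 ^ m` is `P` expanded by `2 ^ m`, and `P` expanded by `M` is a multiple of
the characteristic polynomial of `b`, the sequence `c` satisfies the recurrence of `P ^ 2 ^ (L₁ -
1)`. -/

/-! ### Tridiagonal determinants -/

/-- The tridiagonal matrix with diagonal `d` and all off-diagonal entries `1`. -/
def tridiagonal {R : Type*} [CommRing R] {n : ℕ} (d : Fin n → R) : Matrix (Fin n) (Fin n) R :=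
  Matrix.of fun i j =>
    if i = j then d i else if (i : ℕ) + 1 = j ∨ (j : ℕ) + 1 = i then 1 else 0

theorem det_tridiagonal_succ_succ {R : Type*} [CommRing R] {n : ℕ} (d : Fin (n + 2) → R) :
    (tridiagonal d).det = d 0 * (tridiagonal fun i : Fin (n + 1) => d i.succ).det
      - (tridiagonal fun i : Fin n => d i.succ.succ).det := by
  rw [Matrix.det_succ_row_zero, Fin.sum_univ_succ, Fin.sum_univ_succ, Finset.sum_eq_zero]
  · have h0 : (tridiagonal d).submatrix Fin.succ (Fin.succAbove 0)
        = tridiagonal fun i : Fin (n + 1) => d i.succ := by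
      ext i j
      simp [tridiagonal]
    have h1 : ((tridiagonal d).submatrix Fin.succ (Fin.succAbove (Fin.succ 0))).det
        = (tridiagonal fun i : Fin n => d i.succ.succ).det := by
      rw [Matrix.det_succ_column_zero, Fin.sum_univ_succ, Finset.sum_eq_zero]
      · have h2 : ((tridiagonal d).submatrix Fin.succ (Fin.succAbove (Fin.succ 0))).submatrix
            (Fin.succAbove 0) Fin.succ = tridiagonal fun i : Fin n => d i.succ.succ := by
          ext i j
          simp [tridiagonal]
        rw [h2]
        simp [tridiagonal]
      · intro i _
        simp [tridiagonal, Fin.ext_iff]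
    rw [h0, h1]
    simp [tridiagonal, Fin.ext_iff]
    ring
  · intro i _
    simp [tridiagonal, Fin.ext_iff]

/-! ### Continuants -/

/-- The product of the matrices `!![X + s, 1; 1, 0]`; its entries are the continuants of the string
and of the strings with the first or the last bit removed. -/
noncomputable def contMat (l : List (ZMod 2)) : Matrix (Fin 2) (Fin 2) (ZMod 2)[X] :=
  (l.map fun e => !![X + C e, 1; 1, 0]).prod

theorem contMat_nil : contMat [] = 1 := rfl

theorem contMat_append (l m : List (ZMod 2)) : contMat (l ++ m) = contMat l * contMat m := by
  simp [contMat]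

theorem contMat_singleton (e : ZMod 2) : contMat [e] = !![X + C e, 1; 1, 0] := by
  simp [contMat]

theorem contMat_cons (e : ZMod 2) (l : List (ZMod 2)) :
    contMat (e :: l) = !![X + C e, 1; 1, 0] * contMat l := by
  simp [contMat]

/-- The factors are symmetric, so transposition only reverses their order. -/
theorem contMat_reverse (l : List (ZMod 2)) : contMat l.reverse = (contMat l).transpose := by
  induction l with
  | nil => simp [contMat_nil]
  | cons e l ih =>
    rw [List.reverse_cons, contMat_append, ih, contMat_singleton, contMat_cons,
      Matrix.transpose_mul]
    congr 1
    ext i j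
    fin_cases i <;> fin_cases j <;> rfl

theorem det_contMat (l : List (ZMod 2)) : (contMat l).det = 1 := by
  induction l with
  | nil => simp [contMat_nil]
  | cons e l ih => rw [contMat_cons, Matrix.det_mul, ih, Matrix.det_fin_two_of]; simp [CharTwo.neg_eq]

theorem contMat_det_eq (l : List (ZMod 2)) :
    contMat l 0 0 * contMat l 1 1 + contMat l 0 1 * contMat l 1 0 = 1 := by
  have h := det_contMat l
  rwa [Matrix.det_fin_two, CharTwo.sub_eq_add] at h

theorem contMat_cons_zero_zero (e : ZMod 2) (l : List (ZMod 2)) :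
    contMat (e :: l) 0 0 = (X + C e) * contMat l 0 0 + contMat l 1 0 := by
  simp [contMat_cons, Matrix.mul_apply, Fin.sum_univ_two]

theorem contMat_cons_one_zero (e : ZMod 2) (l : List (ZMod 2)) :
    contMat (e :: l) 1 0 = contMat l 0 0 := by
  simp [contMat_cons, Matrix.mul_apply, Fin.sum_univ_two]

theorem contMat_concat_zero_zero (l : List (ZMod 2)) (e : ZMod 2) :
    contMat (l ++ [e]) 0 0 = contMat l 0 0 * (X + C e) + contMat l 0 1 := by
  simp [contMat_append, contMat_singleton, Matrix.mul_apply, Fin.sum_univ_two]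

theorem contMat_concat_zero_one (l : List (ZMod 2)) (e : ZMod 2) :
    contMat (l ++ [e]) 0 1 = contMat l 0 0 := by
  simp [contMat_append, contMat_singleton, Matrix.mul_apply, Fin.sum_univ_two]

theorem contMat_monic_and_degree (l : List (ZMod 2)) :
    (contMat l 0 0).Monic ∧ (contMat l 0 0).degree = l.length ∧
      (contMat l 1 0).degree < l.length := by
  induction l with
  | nil => simp [contMat_nil]
  | cons e l ih =>
    obtain ⟨hm, hd, hd'⟩ := ih
    have h1 : ((X + C e) * contMat l 0 0).degree = ((l.length + 1 : ℕ) : WithBot ℕ) := by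
      rw [degree_mul, hd, degree_X_add_C, add_comm]; rfl
    have h2 : (contMat l 1 0).degree < ((X + C e) * contMat l 0 0).degree := by
      rw [h1]
      exact hd'.trans (by exact_mod_cast Nat.lt_succ_self _)
    rw [contMat_cons_zero_zero, contMat_cons_one_zero, List.length_cons]
    refine ⟨((monic_X_add_C e).mul hm).add_of_left h2, ?_, ?_⟩
    · rw [degree_add_eq_left_of_degree_lt h2, h1]
    · rw [hd]
      exact_mod_cast Nat.lt_succ_self _

theorem charmatrix_caMatrix (s : List (ZMod 2)) :
    (caMatrix s).charmatrix = tridiagonal fun i => X + C (s.get i) := by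
  ext1 i j
  by_cases h : i = j
  · subst h
    simp [tridiagonal, caMatrix, CharTwo.sub_eq_add]
  · by_cases h' : (i : ℕ) + 1 = j ∨ (j : ℕ) + 1 = i
    · simp [tridiagonal, caMatrix, h, h', CharTwo.neg_eq]
    · simp [tridiagonal, caMatrix, h, h']

/-- The characteristic polynomial of a 90/150 automaton is the continuant of its string. -/
theorem charpoly_caMatrix (s : List (ZMod 2)) : (caMatrix s).charpoly = contMat s 0 0 := by
  rw [Matrix.charpoly, charmatrix_caMatrix]
  suffices h : ∀ n, ∀ s : List (ZMod 2), s.length ≤ n →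
      (tridiagonal fun i => X + C (s.get i)).det = contMat s 0 0 from h _ s le_rfl
  intro n
  induction n with
  | zero =>
    intro s hs
    rw [List.length_eq_zero_iff.1 (Nat.le_zero.1 hs)]
    simp [contMat_nil]
  | succ n ih =>
    intro s hs
    match s with
    | [] => simp [contMat_nil]
    | [e] =>
      rw [contMat_singleton]
      change Matrix.det (n := Fin 1) _ = _
      rw [Matrix.det_fin_one]
      simp [tridiagonal]
    | e :: f :: l =>
      simp only [List.length_cons] at hs
      rw [contMat_cons_zero_zero, contMat_cons_one_zero, ← ih (f :: l) (by simp; omega),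
        ← ih l (by omega), ← CharTwo.sub_eq_add]
      exact det_tridiagonal_succ_succ (n := l.length) fun i => X + C ((e :: f :: l).get i)

/-! ### The differential equation satisfied by continuants -/

/-- The Riccati-type relation between the continuant `p` of a string over `GF(2)` and the continuant
`q` of the string without its first bit. -/
def ContRel (p q : (ZMod 2)[X]) : Prop :=
  (X ^ 2 + X) * derivative (q * p) = p ^ 2 + q * p + q ^ 2 + 1

/-- Because `e ^ 2 = e`, the same coefficient serves both rules; this makes `ContRel` independent of
the bits. -/
theorem X_add_C_sq_add (e : ZMod 2) : (X + C e) ^ 2 + (X + C e) = (X ^ 2 + X : (ZMod 2)[X]) := by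
  have h : e ^ 2 + e = 0 := by revert e; decide
  have h' : (C e : (ZMod 2)[X]) ^ 2 + C e = 0 := by rw [← C_pow, ← C_add, h, C_0]
  linear_combination h' + X * C e * CharTwo.two_eq_zero (R := (ZMod 2)[X])

/-- With `p = (X + e) q + r`, the left side gains `(X ^ 2 + X) q ^ 2` because `((X + e) q ^ 2)' = q
^ 2`, and the right side gains `((X + e) ^ 2 + (X + e)) q ^ 2`; these cancel. -/
theorem contRel_step (e : ZMod 2) (q r : (ZMod 2)[X]) :
    ContRel ((X + C e) * q + r) q ↔ ContRel q r := by
  have h := X_add_C_sq_add e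
  have h2 := CharTwo.two_eq_zero (R := (ZMod 2)[X])
  simp only [ContRel, derivative_mul, derivative_add, derivative_X, derivative_C]
  constructor <;> intro H
  · linear_combination H - q ^ 2 * h + h2 * (q ^ 2 * X ^ 2 + q ^ 2 * X
      - (X ^ 2 + X) * q * derivative q * (X + C e)
      + q * r * (X + C e) + q ^ 2 * (2 * X * C e - X - X ^ 2 + C e + C e ^ 2))
  · linear_combination H + q ^ 2 * h - h2 * (q ^ 2 * X ^ 2 + q ^ 2 * X
      - (X ^ 2 + X) * q * derivative q * (X + C e)
      + q * r * (X + C e) + q ^ 2 * (2 * X * C e - X - X ^ 2 + C e + C e ^ 2))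

theorem contRel_contMat (l : List (ZMod 2)) : ContRel (contMat l 0 0) (contMat l 1 0) := by
  induction l with
  | nil => simp [contMat_nil, ContRel, CharTwo.add_self_eq_zero]
  | cons e l ih =>
    rw [contMat_cons_zero_zero, contMat_cons_one_zero]
    exact (contRel_step e _ _).2 ih

theorem monic_of_ne_zero_zmod_two {p : (ZMod 2)[X]} (hp : p ≠ 0) : p.Monic := by
  have h := leadingCoeff_ne_zero.2 hp
  rw [Monic]
  generalize p.leadingCoeff = c at h
  revert h c
  decide

/-- The right side has degree `2 deg p` and the left at most `deg p + deg q + 1`. -/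
theorem ContRel.natDegree_add_one {p q : (ZMod 2)[X]} (h : ContRel p q) (hd : q.degree < p.degree)
    (hp : p.natDegree ≠ 0) : q ≠ 0 ∧ q.natDegree + 1 = p.natDegree := by
  have hlt : q.natDegree < p.natDegree := by
    rcases eq_or_ne q 0 with rfl | hq
    · simpa using Nat.pos_of_ne_zero hp
    · exact natDegree_lt_natDegree hq hd
  have hR : (p ^ 2 + (q * p + q ^ 2 + 1)).natDegree = 2 * p.natDegree := by
    rw [natDegree_add_eq_left_of_natDegree_lt, natDegree_pow]
    rw [natDegree_pow]
    have h1 : (q * p).natDegree ≤ q.natDegree + p.natDegree := natDegree_mul_le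
    have h2 : (q ^ 2).natDegree ≤ 2 * q.natDegree := natDegree_pow_le
    have h3 := natDegree_add_le (q * p + q ^ 2) 1
    have h4 := natDegree_add_le (q * p) (q ^ 2)
    rw [natDegree_one] at h3
    omega
  have hL : ((X ^ 2 + X) * derivative (q * p)).natDegree
      ≤ 2 + (q.natDegree + p.natDegree - 1) := by
    refine natDegree_mul_le.trans (add_le_add ?_ ?_)
    · compute_degree
    · exact (natDegree_derivative_le _).trans (Nat.sub_le_sub_right natDegree_mul_le 1)
  rw [ContRel] at h
  rw [h, show p ^ 2 + q * p + q ^ 2 + 1 = p ^ 2 + (q * p + q ^ 2 + 1) by ring, hR] at hL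
  refine ⟨?_, by omega⟩
  rintro rfl
  have h5 := congrArg natDegree h
  rw [show p ^ 2 + 0 * p + 0 ^ 2 + 1 = p ^ 2 + (0 * p + 0 ^ 2 + 1) by ring, hR] at h5
  simp at h5
  exact hp (by rw [← h5])

/-- By the Euclidean algorithm, `ContRel` characterizes the continuants. -/
theorem ContRel.exists_contMat {p q : (ZMod 2)[X]} (h : ContRel p q) (hd : q.degree < p.degree) :
    ∃ l, contMat l 0 0 = p ∧ contMat l 1 0 = q := by
  obtain ⟨n, hn⟩ : ∃ n, p.natDegree = n := ⟨_, rfl⟩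
  induction n generalizing p q with
  | zero =>
    have hp0 : p ≠ 0 := by rintro rfl; simp at hd
    have hp1 : p = 1 := (monic_of_ne_zero_zmod_two hp0).natDegree_eq_zero.1 hn
    subst hp1
    rw [degree_one, Nat.WithBot.lt_zero_iff, degree_eq_bot] at hd
    exact ⟨[], by simp [contMat_nil], by simp [contMat_nil, hd]⟩
  | succ n ih =>
    obtain ⟨hq0, hqn⟩ := h.natDegree_add_one hd (by omega)
    have hqm := monic_of_ne_zero_zmod_two hq0
    have hp0 : p ≠ 0 := by rintro rfl; simp at hn
    have hpm := monic_of_ne_zero_zmod_two hp0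
    -- The degree drops by exactly one, so the quotient is `X + e`, and `e` is the next bit of the
    -- string.
    have hdd : (p /ₘ q).natDegree = 1 := by rw [natDegree_divByMonic p hqm]; omega
    have hdm : (p /ₘ q).Monic := monic_of_ne_zero_zmod_two (by rintro h0; simp [h0] at hdd)
    have hdiv := modByMonic_add_div p q
    rw [hdm.eq_X_add_C hdd, add_comm, mul_comm] at hdiv
    rw [← hdiv, contRel_step] at h
    obtain ⟨l, hl, hl'⟩ := ih h (degree_modByMonic_lt p hqm) (by omega)
    refine ⟨(p /ₘ q).coeff 0 :: l, ?_, ?_⟩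
    · rw [contMat_cons_zero_zero, hl, hl', hdiv]
    · rw [contMat_cons_one_zero, hl]

/-- Uniqueness of division with remainder recovers the first bit, then the rest by recursion. -/
theorem contMat_injective {s t : List (ZMod 2)} (h0 : contMat s 0 0 = contMat t 0 0)
    (h1 : contMat s 1 0 = contMat t 1 0) : s = t := by
  have hlen : s.length = t.length := by
    have h := (contMat_monic_and_degree s).2.1
    rw [h0, (contMat_monic_and_degree t).2.1] at h
    exact_mod_cast h.symm
  induction s generalizing t with
  | nil => exact (List.length_eq_zero_iff.1 hlen.symm).symm
  | cons e l ih =>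
    match t, hlen with
    | f :: m, hlen =>
      rw [contMat_cons_one_zero, contMat_cons_one_zero] at h1
      rw [contMat_cons_zero_zero, contMat_cons_zero_zero, h1] at h0
      have hlm : l.length = m.length := by simpa using hlen
      obtain ⟨hm, hdm, hdm'⟩ := contMat_monic_and_degree m
      have hdl := (contMat_monic_and_degree l).2.2
      have hef : C (e - f) * contMat m 0 0 = contMat m 1 0 - contMat l 1 0 := by
        rw [C_sub]
        linear_combination h0
      have he : e = f := by
        by_contra hne
        have h2 : (C (e - f) * contMat m 0 0).degree = m.length := by
          rw [degree_C_mul (sub_ne_zero.2 hne), hdm]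
        rw [hef] at h2
        have h3 := (degree_sub_le (contMat m 1 0) (contMat l 1 0)).trans_lt
          (max_lt hdm' (hlm ▸ hdl))
        exact h3.ne h2
      subst he
      rw [ih h1 (by simpa [sub_eq_zero, eq_comm] using hef) hlm]

/-- The Cattell–Muzio congruence. -/
theorem ContRel.dvd {p q : (ZMod 2)[X]} (h : ContRel p q) :
    p ∣ q ^ 2 + (X ^ 2 + X) * derivative p * q + 1 := by
  rw [ContRel, derivative_mul] at h
  refine ⟨p + q - (X ^ 2 + X) * derivative q, ?_⟩
  linear_combination h + CharTwo.two_eq_zero (R := (ZMod 2)[X]) * (q ^ 2 + 1)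

/-! ### Uniqueness of the automaton up to reversal. -/

theorem contMat_reverse_zero_zero (l : List (ZMod 2)) :
    contMat l.reverse 0 0 = contMat l 0 0 := by
  rw [contMat_reverse, Matrix.transpose_apply]

theorem contMat_reverse_one_zero (l : List (ZMod 2)) :
    contMat l.reverse 1 0 = contMat l 0 1 := by
  rw [contMat_reverse, Matrix.transpose_apply]

theorem contMat_zero_one_degree (l : List (ZMod 2)) : (contMat l 0 1).degree < l.length := by
  rw [← contMat_reverse_one_zero, ← List.length_reverse]
  exact (contMat_monic_and_degree _).2.2

theorem eq_or_eq_reverse_of_contMat_eq {s t : List (ZMod 2)} (hirr : Irreducible (contMat s 0 0))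
    (h : contMat t 0 0 = contMat s 0 0) : t = s ∨ t = s.reverse := by
  have h2 := CharTwo.two_eq_zero (R := (ZMod 2)[X])
  have hpr := hirr.prime
  have hds := (contMat_monic_and_degree s).2
  have hdt := (contMat_monic_and_degree t).2
  rw [h] at hdt
  have hlen : (t.length : WithBot ℕ) = s.length := by rw [← hds.1, ← hdt.1]
  have key : ∀ r : (ZMod 2)[X], r.degree < s.length →
      contMat s 0 0 ∣ contMat t 1 0 - r → contMat t 1 0 = r := by
    intro r hr hdvd
    refine sub_eq_zero.1 (eq_zero_of_dvd_of_degree_lt hdvd ?_)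
    rw [hds.1]
    exact (degree_sub_le _ _).trans_lt (max_lt (hlen ▸ hdt.2) hr)
  obtain ⟨u, hu⟩ := (contRel_contMat s).dvd
  obtain ⟨v, hv⟩ := (contRel_contMat t).dvd
  rw [h] at hv
  have hdet := contMat_det_eq s
  have hmul : contMat s 0 0 ∣ (contMat t 1 0 - contMat s 1 0) *
      (contMat t 1 0 + contMat s 1 0 + (X ^ 2 + X) * derivative (contMat s 0 0)) :=
    ⟨v - u, by linear_combination hv - hu⟩
  rcases hpr.dvd_or_dvd hmul with h1 | h1
  · exact Or.inl (contMat_injective h (key _ hds.2 h1))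
  · right
    refine contMat_injective (h.trans (contMat_reverse_zero_zero s).symm) ?_
    rw [contMat_reverse_one_zero]
    refine key _ (contMat_zero_one_degree s) ?_
    obtain ⟨w, hw⟩ := h1
    -- The two roots of the quadratic have product `1`, and by the determinant the off-diagonal
    -- entries of `contMat s` are mutually inverse modulo `contMat s 0 0`.
    have hmul' : contMat s 0 0 ∣ contMat s 1 0 * (contMat t 1 0 - contMat s 0 1) :=
      ⟨contMat s 1 0 * w - u + contMat s 1 1, by
        linear_combination contMat s 1 0 * hw - hu + hdet
            + h2 * (1 - contMat s 0 0 * contMat s 1 1 - contMat s 0 1 * contMat s 1 0)⟩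
    refine (hpr.dvd_or_dvd hmul').resolve_left fun hbad => hpr.not_isUnit ?_
    refine isUnit_of_dvd_one ?_
    rw [← hdet]
    exact dvd_add (dvd_mul_right _ _) (hbad.mul_left _)

/-- For a palindrome the determinant gives `q ^ 2 ≡ 1`, so `q = 1`, whereas `q` must have degree one
less than `p`. -/
theorem ne_reverse_of_irreducible {s : List (ZMod 2)} (hirr : Irreducible (contMat s 0 0))
    (hlen : 2 ≤ s.length) : s ≠ s.reverse := by
  intro hs
  have h2 := CharTwo.two_eq_zero (R := (ZMod 2)[X])
  have h01 : contMat s 0 1 = contMat s 1 0 := by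
    rw [← contMat_reverse_one_zero, ← hs]
  have hdet := contMat_det_eq s
  rw [h01] at hdet
  have hds := (contMat_monic_and_degree s).2
  have hdvd : contMat s 0 0 ∣ (contMat s 1 0 + 1) ^ 2 :=
    ⟨contMat s 1 1, by
      linear_combination hdet + h2 * (contMat s 1 0 + 1 - contMat s 0 0 * contMat s 1 1)⟩
  have h0 : contMat s 1 0 + 1 = 0 := by
    refine eq_zero_of_dvd_of_degree_lt (hirr.prime.dvd_of_dvd_pow hdvd) ?_
    rw [hds.1]
    refine (degree_add_le _ _).trans_lt (max_lt hds.2 ?_)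
    rw [degree_one]
    exact_mod_cast (by omega : 0 < s.length)
  have h1 : contMat s 1 0 = 1 := CharTwo.add_eq_zero.1 h0
  have hnd := (contRel_contMat s).natDegree_add_one (by rw [hds.1]; exact hds.2)
    (by rw [natDegree_eq_of_degree_eq_some hds.1]; omega)
  rw [h1, natDegree_one, natDegree_eq_of_degree_eq_some hds.1] at hnd
  omega

/-! ### Existence of the Cattell–Muzio automata -/

/-- **Euler's formula** for the traces of `f(x)` divided by the derivative of the minimal
polynomial. -/
theorem trace_aeval_div_derivative {K L : Type*} [Field K] [Field L] [Algebra K L]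
    [FiniteDimensional K L] [Algebra.IsSeparable K L] (pb : PowerBasis K L) (f : K[X])
    (hf : f.degree < pb.dim) :
    Algebra.trace K L (aeval pb.gen f / aeval pb.gen (derivative (minpoly K pb.gen)))
      = f.coeff (pb.dim - 1) := by
  have hpos : 0 < pb.dim := pb.dim_pos
  set m : Fin pb.dim := ⟨pb.dim - 1, by omega⟩ with hm
  have hlead : (minpolyDiv K pb.gen).coeff m = 1 := by
    have h1 := natDegree_minpolyDiv_succ (pb.isIntegral_gen)
    rw [pb.natDegree_minpoly] at h1
    have h2 := minpolyDiv_monic (pb.isIntegral_gen)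
    rw [Monic, leadingCoeff] at h2
    rwa [show (minpolyDiv K pb.gen).natDegree = m by simp only [hm]; omega] at h2
  have hdual := Module.Basis.traceDual_powerBasis_eq pb m
  rw [hlead] at hdual
  have hij := (Module.Basis.traceDual_eq_iff (b := pb.basis) (v := pb.basis.traceDual)).1 rfl m
  have hf' : aeval pb.gen f = ∑ j : Fin pb.dim, f.coeff j • pb.basis j := by
    rw [aeval_eq_sum_range' (n := pb.dim), Finset.sum_range]
    · simp
    · rcases eq_or_ne f 0 with rfl | h0
      · simpa using hpos
      · exact (natDegree_lt_iff_degree_lt h0).2 hf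
  rw [div_eq_mul_one_div, ← hdual, hf', Finset.sum_mul, map_sum, Finset.sum_eq_single m]
  · have h := hij m
    rw [Algebra.traceForm_apply, if_pos rfl, mul_comm] at h
    rw [smul_mul_assoc, map_smul, h, smul_eq_mul, mul_one]
  · intro j _ hj
    have h := hij j
    rw [Algebra.traceForm_apply, if_neg hj, mul_comm] at h
    rw [smul_mul_assoc, map_smul, h, smul_zero]
  · simp

theorem trace_sq_zmod_two {F : Type*} [Field F] [Algebra (ZMod 2) F] [FiniteDimensional (ZMod 2) F]
    (x : F) : Algebra.trace (ZMod 2) F (x ^ 2) = Algebra.trace (ZMod 2) F x := by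
  have h := Algebra.trace_eq_of_algEquiv (FiniteField.frobeniusAlgEquivOfAlgebraic (ZMod 2) F) x
  rwa [FiniteField.coe_frobeniusAlgEquivOfAlgebraic, ZMod.card] at h

/-- **Additive Hilbert 90** for finite extensions of `GF(2)`. -/
theorem exists_sq_add_self_eq {F : Type*} [Field F] [Algebra (ZMod 2) F]
    [FiniteDimensional (ZMod 2) F] (c : F) (hc : Algebra.trace (ZMod 2) F c = 0) :
    ∃ z : F, z ^ 2 + z = c := by
  have : CharP F 2 := charP_of_injective_algebraMap (algebraMap (ZMod 2) F).injective 2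
  let φ : F →ₗ[ZMod 2] F :=
    (FiniteField.frobeniusAlgEquivOfAlgebraic (ZMod 2) F).toLinearMap + LinearMap.id
  have hφ : ∀ z, φ z = z ^ 2 + z := fun z => by
    have h := congrFun (FiniteField.coe_frobeniusAlgEquivOfAlgebraic (ZMod 2) F) z
    rw [ZMod.card] at h
    simp only [φ, LinearMap.add_apply, AlgEquiv.toLinearMap_apply, LinearMap.id_apply, h]
  -- The kernel of `z ↦ z ^ 2 + z` is `GF(2)`, so its range has codimension at most one and fills
  -- the trace-zero hyperplane.
  have hker : Module.finrank (ZMod 2) (LinearMap.ker φ) ≤ 1 := by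
    refine finrank_le_one (⟨1, ?_⟩ : LinearMap.ker φ) ?_
    · rw [LinearMap.mem_ker, hφ]
      simp [CharTwo.add_self_eq_zero]
    · rintro ⟨z, hz⟩
      rw [LinearMap.mem_ker, hφ] at hz
      have hz' : z * (z + 1) = 0 := by linear_combination hz
      rcases mul_eq_zero.1 hz' with h | h
      · exact ⟨0, by ext; simp [h]⟩
      · exact ⟨1, by ext; simp [CharTwo.add_eq_zero.1 h]⟩
  have hle : LinearMap.range φ ≤ LinearMap.ker (Algebra.trace (ZMod 2) F) := by
    rintro _ ⟨z, rfl⟩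
    rw [LinearMap.mem_ker, hφ, map_add, trace_sq_zmod_two, CharTwo.add_self_eq_zero]
  have h1 := LinearMap.finrank_range_add_finrank_ker φ
  have h2 := LinearMap.finrank_range_add_finrank_ker (Algebra.trace (ZMod 2) F)
  rw [LinearMap.range_eq_top.2 (Algebra.trace_surjective (ZMod 2) F), finrank_top,
    Module.finrank_self] at h2
  have heq := Submodule.eq_of_le_of_finrank_le hle (by omega)
  have hmem : c ∈ LinearMap.range φ := by rw [heq]; exact hc
  obtain ⟨z, hz⟩ := hmem
  exact ⟨z, by rw [← hφ, hz]⟩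

theorem eval_eq_one_of_irreducible {P : (ZMod 2)[X]} (hP : Irreducible P) (hn : 2 ≤ P.natDegree)
    (e : ZMod 2) : P.eval e = 1 := by
  have h : P.eval e ≠ 0 := by
    intro h0
    have h1 : P.natDegree = 1 := natDegree_eq_of_degree_eq_some
      (degree_eq_one_of_irreducible_of_root hP (x := e) h0)
    omega
  generalize P.eval e = c at h
  revert h c
  decide

/-- At a root `θ` of `P`, the value `g(θ)` is the inverse of `θ + e`; the exact degree of `g` lets
Euler's formula give a trace equal to `1`. -/
theorem exists_mul_X_add_C_add_one {P : (ZMod 2)[X]} (hP : Irreducible P) (hn : 2 ≤ P.natDegree)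
    (e : ZMod 2) : ∃ g : (ZMod 2)[X], (X + C e) * g + 1 = P ∧ g.natDegree + 1 = P.natDegree := by
  have hr : (P + 1).IsRoot e := by
    simp [eval_eq_one_of_irreducible hP hn, CharTwo.add_self_eq_zero]
  have h := mul_divByMonic_eq_iff_isRoot.2 hr
  rw [CharTwo.sub_eq_add] at h
  refine ⟨(P + 1) /ₘ (X + C e), ?_, ?_⟩
  · rw [h, add_assoc, CharTwo.add_self_eq_zero, add_zero]
  · rw [natDegree_divByMonic _ (monic_X_add_C e), natDegree_X_add_C,
      natDegree_add_eq_left_of_natDegree_lt (by rw [natDegree_one]; omega)]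
    omega

/-- The quadratic congruence of Cattell and Muzio has a solution of exact degree `n - 1`. -/
theorem exists_sq_congruence {P : (ZMod 2)[X]} (hP : Irreducible P) (hn : 2 ≤ P.natDegree) :
    ∃ y : (ZMod 2)[X], y.degree < P.natDegree ∧ y.coeff (P.natDegree - 1) = 1 ∧
      P ∣ y ^ 2 + (X ^ 2 + X) * derivative P * y + 1 := by
  have : Fact (Irreducible P) := ⟨hP⟩
  have hPm := monic_of_ne_zero_zmod_two hP.ne_zero
  let pb := AdjoinRoot.powerBasis hP.ne_zero
  have : FiniteDimensional (ZMod 2) (AdjoinRoot P) := pb.finite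
  have : CharP (AdjoinRoot P) 2 :=
    charP_of_injective_algebraMap (algebraMap (ZMod 2) (AdjoinRoot P)).injective 2
  set θ := AdjoinRoot.root P with hθ
  have hmin : minpoly (ZMod 2) θ = P :=
    (minpoly.eq_of_irreducible_of_monic hP (by simp [hθ]) hPm).symm
  have hδ0 : aeval θ (derivative P) ≠ 0 := by
    have hsep := Algebra.IsSeparable.isSeparable (ZMod 2) θ
    rw [IsSeparable, hmin] at hsep
    exact hsep.aeval_derivative_ne_zero (by simp [hθ])
  set δ := aeval θ (derivative P) with hδ
  have htr : ∀ f : (ZMod 2)[X], f.degree < P.natDegree →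
      Algebra.trace (ZMod 2) _ (aeval θ f / δ) = f.coeff (P.natDegree - 1) := by
    intro f hf
    have h := trace_aeval_div_derivative pb f (by simpa [pb] using hf)
    simpa only [pb, AdjoinRoot.powerBasis_gen, AdjoinRoot.powerBasis_dim, ← hθ, hmin] using h
  have hinv : ∀ e : ZMod 2, (θ + algebraMap _ _ e) ≠ 0 ∧
      Algebra.trace (ZMod 2) _ ((θ + algebraMap _ _ e)⁻¹ / δ) = 1 := by
    intro e
    obtain ⟨g, hg, hgn⟩ := exists_mul_X_add_C_add_one hP hn e
    have h := congrArg (aeval θ) hg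
    rw [map_add, map_mul, map_add, aeval_X, aeval_C, map_one, AdjoinRoot.aeval_eq P,
      AdjoinRoot.mk_self, CharTwo.add_eq_zero] at h
    refine ⟨left_ne_zero_of_mul_eq_one h, ?_⟩
    rw [inv_eq_of_mul_eq_one_right h, htr]
    · have hg0 : g ≠ 0 := by rintro rfl; simp at hgn; omega
      rw [← hgn, Nat.add_sub_cancel]
      exact monic_of_ne_zero_zmod_two hg0
    · exact degree_le_natDegree.trans_lt (by exact_mod_cast (by omega))
  obtain ⟨hθ0, ht0⟩ := hinv 0
  obtain ⟨hθ1, ht1⟩ := hinv 1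
  rw [map_zero, add_zero] at hθ0 ht0
  rw [map_one] at hθ1 ht1
  have h2 : (2 : AdjoinRoot P) = 0 := CharTwo.two_eq_zero
  -- Substituting `y = β z` turns `y ^ 2 + β y + 1 = 0` into `z ^ 2 + z = β⁻¹ ^ 2`. Partial
  -- fractions split `β⁻¹` into two terms of trace `1`.
  set β := (θ ^ 2 + θ) * δ with hβ
  have hβ0 : β ≠ 0 := by
    rw [hβ, show θ ^ 2 + θ = θ * (θ + 1) by ring]
    exact mul_ne_zero (mul_ne_zero hθ0 hθ1) hδ0
  have hβinv : β⁻¹ = θ⁻¹ / δ + (θ + 1)⁻¹ / δ := by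
    rw [hβ, show θ ^ 2 + θ = θ * (θ + 1) by ring]
    field_simp
    linear_combination -h2 * θ
  obtain ⟨z, hz⟩ := exists_sq_add_self_eq (β⁻¹ ^ 2) (by
    rw [trace_sq_zmod_two, hβinv, map_add, ht0, ht1, CharTwo.add_self_eq_zero])
  obtain ⟨f, hf⟩ := AdjoinRoot.mk_surjective (β * z)
  have hy : aeval θ (f %ₘ P) = β * z := by
    rw [AdjoinRoot.aeval_eq, ← hf, AdjoinRoot.mk_eq_mk]
    exact ⟨-(f /ₘ P), by rw [modByMonic_eq_sub_mul_div]; ring⟩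
  have hdeg : (f %ₘ P).degree < P.natDegree := by
    rw [← degree_eq_natDegree hP.ne_zero]
    exact degree_modByMonic_lt f hPm
  refine ⟨f %ₘ P, hdeg, ?_, ?_⟩
  -- The top coefficient is `Tr(y / δ) = Tr(θ ^ 2 z + θ z)`. Squaring the second term under the
  -- trace gives `Tr(θ ^ 2 (z ^ 2 + z)) = Tr((θ / β) ^ 2) = Tr((θ + 1)⁻¹ / δ) = 1`.
  · rw [← htr _ hdeg, hy, hβ, show (θ ^ 2 + θ) * δ * z / δ = θ ^ 2 * z + θ * z by field_simp,
      map_add, ← trace_sq_zmod_two (θ * z), ← map_add,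
      show θ ^ 2 * z + (θ * z) ^ 2 = θ ^ 2 * (z ^ 2 + z) by ring, hz, ← mul_pow, trace_sq_zmod_two,
      ← ht1, hβ, show θ ^ 2 + θ = θ * (θ + 1) by ring]
    congr 1
    field_simp
  · rw [← AdjoinRoot.mk_eq_zero, ← AdjoinRoot.aeval_eq]
    simp only [map_add, map_mul, map_pow, map_one, aeval_X, hy, ← hθ, ← hδ, ← hβ]
    have h3 : β ^ 2 * (z ^ 2 + z) = 1 := by
      rw [hz, ← mul_pow, mul_inv_cancel₀ hβ0, one_pow]
    linear_combination h3 + h2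

theorem derivative_derivative_zmod_two (f : (ZMod 2)[X]) : derivative (derivative f) = 0 := by
  ext n
  rw [coeff_derivative, coeff_derivative, coeff_zero]
  push_cast
  generalize f.coeff (n + 1 + 1) = c
  generalize (n : ZMod 2) = m
  revert c m
  decide

/-- The defect `G` of `ContRel` is divisible by `P` and has zero derivative, so it is a square and
`P ^ 2` divides it. Since `y` has degree exactly `n - 1`, the terms of degree `2n` in `G` cancel,
which forces `G = 0`. -/
theorem contRel_of_dvd {P y : (ZMod 2)[X]} (hP : Irreducible P) (hn : 1 ≤ P.natDegree)
    (hd : y.degree < P.natDegree) (hc : y.coeff (P.natDegree - 1) = 1)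
    (hdvd : P ∣ y ^ 2 + (X ^ 2 + X) * derivative P * y + 1) : ContRel P y := by
  have h2 := CharTwo.two_eq_zero (R := (ZMod 2)[X])
  have hPm := monic_of_ne_zero_zmod_two hP.ne_zero
  have hyd : y.natDegree ≤ P.natDegree - 1 := by
    rcases eq_or_ne y 0 with rfl | hy0
    · simp
    · exact Nat.le_sub_one_of_lt ((natDegree_lt_iff_degree_lt hy0).2 hd)
  set G := (X ^ 2 + X) * derivative (y * P) + (P ^ 2 + y * P + y ^ 2 + 1) with hG
  have hPG : P ∣ G := by
    obtain ⟨w, hw⟩ := hdvd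
    refine ⟨w + (X ^ 2 + X) * derivative y + P + y, ?_⟩
    rw [hG, derivative_mul]
    linear_combination hw
  have hG' : derivative G = 0 := by
    have hdd := derivative_derivative_zmod_two (y * P)
    rw [hG, derivative_add, derivative_add, derivative_add, derivative_add, derivative_mul, hdd,
      derivative_sq, derivative_sq]
    simp only [derivative_add, derivative_X_sq, derivative_X, derivative_one]
    rw [show (C (2 : ZMod 2) : (ZMod 2)[X]) = 0 from by rw [show (2 : ZMod 2) = 0 from rfl, C_0]]
    linear_combination h2 * derivative (y * P)
  obtain ⟨g, hg⟩ : ∃ g, G = g ^ 2 :=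
    ⟨_, by rw [← ZMod.expand_card, expand_contract 2 hG' two_ne_zero]⟩
  have hPP : P ^ 2 ∣ G := by
    rw [hg] at hPG ⊢
    exact pow_dvd_pow_of_dvd (hP.prime.dvd_of_dvd_pow hPG) 2
  have hGd : G.degree < (P ^ 2).degree := by
    set n := P.natDegree with hn'
    have hyn : y.natDegree = n - 1 :=
      le_antisymm hyd (le_natDegree_of_ne_zero (by rw [hc]; exact one_ne_zero))
    have hym : y.Monic := by rw [Monic, leadingCoeff, hyn, hc]
    have hyP : (y * P).natDegree = 2 * n - 2 + 1 := by
      rw [hym.natDegree_mul hPm, hyn]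
      omega
    have hDle : (derivative (y * P)).natDegree ≤ 2 * n - 2 :=
      (natDegree_derivative_le _).trans (by omega)
    -- The degree `2n - 1` of `y * P` is odd, so the leading term survives differentiation.
    have hDm : (derivative (y * P)).coeff (2 * n - 2) = 1 := by
      rw [coeff_derivative, ← hyP, (hym.mul hPm).coeff_natDegree,
        show ((2 * n - 2 : ℕ) : ZMod 2) = 0 from (ZMod.natCast_eq_zero_iff _ _).2 ⟨n - 1, by omega⟩]
      simp
    have hDn : (derivative (y * P)).natDegree = 2 * n - 2 :=
      le_antisymm hDle (le_natDegree_of_ne_zero (by rw [hDm]; exact one_ne_zero))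
    have hDM : (derivative (y * P)).Monic := by rw [Monic, leadingCoeff, hDn, hDm]
    have hu : (X ^ 2 + X : (ZMod 2)[X]).Monic := by monicity!
    have hun : (X ^ 2 + X : (ZMod 2)[X]).natDegree = 2 := by compute_degree!
    have hP2 : (P ^ 2).degree = ((2 * n : ℕ) : WithBot ℕ) := by
      rw [degree_eq_natDegree (pow_ne_zero 2 hP.ne_zero), natDegree_pow]
    have hL : ((X ^ 2 + X) * derivative (y * P)).degree = (P ^ 2).degree := by
      rw [hP2, degree_eq_natDegree (hu.mul hDM).ne_zero, hu.natDegree_mul hDM, hun, hDn]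
      congr 1
      omega
    have hsub := degree_sub_lt_left hL (hu.mul hDM).ne_zero
      ((hu.mul hDM).leadingCoeff.trans (hPm.pow 2).leadingCoeff.symm)
    rw [hL] at hsub
    have hrest : (y * P + y ^ 2 + 1).degree < (P ^ 2).degree := by
      rw [hP2]
      refine degree_le_natDegree.trans_lt (Nat.cast_lt.2 ?_)
      have h3 := natDegree_add_le (y * P + y ^ 2) 1
      have h4 := natDegree_add_le (y * P) (y ^ 2)
      rw [natDegree_one] at h3
      rw [hym.natDegree_pow, hyP] at h4
      omega
    rw [show G = ((X ^ 2 + X) * derivative (y * P) - P ^ 2) + (y * P + y ^ 2 + 1) by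
      rw [hG]; linear_combination h2 * P ^ 2]
    exact (degree_add_le _ _).trans_lt (max_lt hsub hrest)
  have hG0 := eq_zero_of_dvd_of_degree_lt hPP hGd
  exact CharTwo.add_eq_zero.1 hG0

/-- Every irreducible polynomial over `GF(2)` is the characteristic polynomial of some 90/150
automaton. -/
theorem exists_contMat_eq_of_irreducible {P : (ZMod 2)[X]} (hP : Irreducible P) :
    ∃ l, contMat l 0 0 = P := by
  have hPm := monic_of_ne_zero_zmod_two hP.ne_zero
  rcases hP.natDegree_pos.nat_succ_le.eq_or_lt with h1 | hn
  -- A linear `P` has a root in `GF(2)`, so the trace argument does not apply to it.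
  · refine ⟨[P.coeff 0], ?_⟩
    rw [contMat_singleton]
    exact (hPm.eq_X_add_C h1.symm).symm
  · obtain ⟨y, hd, hc, hdvd⟩ := exists_sq_congruence hP hn
    obtain ⟨l, hl, -⟩ := (contRel_of_dvd hP hP.natDegree_pos hd hc hdvd).exists_contMat
      (by rwa [degree_eq_natDegree hP.ne_zero])
    exact ⟨l, hl⟩

theorem exists_isCattellMuzioPair {P : (ZMod 2)[X]} (hP : Irreducible P) :
    ∃ s₁ s₂, IsCattellMuzioPair P s₁ s₂ ∧ (2 ≤ P.natDegree → s₁ ≠ s₂) := by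
  obtain ⟨s, hs⟩ := exists_contMat_eq_of_irreducible hP
  refine ⟨s, s.reverse, ⟨fun t => ?_, rfl⟩, fun hn => ?_⟩
  · rw [charpoly_caMatrix]
    constructor
    · intro h
      exact eq_or_eq_reverse_of_contMat_eq (by rwa [hs]) (h.trans hs.symm)
    · rintro (rfl | rfl)
      · exact hs
      · rw [contMat_reverse_zero_zero, hs]
  · refine ne_reverse_of_irreducible (by rwa [hs]) ?_
    rwa [← natDegree_eq_of_degree_eq_some (contMat_monic_and_degree s).2.1, hs]

/-! ### Doubling -/

theorem complementLast_concat (l : List (ZMod 2)) (e : ZMod 2) :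
    complementLast (l ++ [e]) = l ++ [e + 1] := by
  have h : (l ++ [e]).modify l.length (fun y => y + 1) = l ++ [e + 1] := by
    induction l with
    | nil => rfl
    | cons f l ih => simpa using ih
  simpa [complementLast] using h

theorem length_doubling (s : List (ZMod 2)) : (doubling s).length = 2 * s.length := by
  simp [doubling, complementLast, two_mul]

theorem length_iterate_doubling (n : ℕ) (s : List (ZMod 2)) :
    (doubling^[n] s).length = s.length * 2 ^ n := by
  induction n with
  | zero => simp
  | succ n ih => rw [Function.iterate_succ_apply', length_doubling, ih, pow_succ]; ring

/-- The new continuant is the sum of the squares of the first row of the complemented half.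
Complementing the last bit adds `contMat l 0 0` to the first entry, and its square cancels that of
the second. -/
theorem contMat_doubling {s : List (ZMod 2)} (hs : s ≠ []) :
    contMat (doubling s) 0 0 = contMat s 0 0 ^ 2 := by
  obtain ⟨l, e, rfl⟩ := (List.eq_nil_or_concat' s).resolve_left hs
  rw [doubling, complementLast_concat, contMat_append, contMat_reverse, Matrix.mul_apply,
    Fin.sum_univ_two, Matrix.transpose_apply, Matrix.transpose_apply, contMat_concat_zero_zero,
    contMat_concat_zero_zero, contMat_concat_zero_one, C_add, C_1]
  linear_combination CharTwo.two_eq_zero (R := (ZMod 2)[X]) *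
    (contMat l 0 0 ^ 2 * (X + C e) + contMat l 0 0 ^ 2 + contMat l 0 0 * contMat l 0 1)

theorem reverse_doubling (s : List (ZMod 2)) : (doubling s).reverse = doubling s := by
  simp [doubling]

/-- Prefixes shorter than `s` are prefixes of `s`. If `P` divides a longer prefix continuant,
splitting the palindrome after that prefix shows that `P` divides either both entries of a row of a
matrix of determinant `1`, or the continuant of the part beyond the next cell, which mirrors a short
prefix. -/
theorem not_dvd_contMat_take_doubling {P : (ZMod 2)[X]} (hP : Prime P) {s : List (ZMod 2)}
    (hs : s ≠ []) (hPs : P ∣ contMat s 0 0)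
    (h : ∀ j < s.length, ¬ P ∣ contMat (s.take j) 0 0) :
    ∀ j < (doubling s).length, ¬ P ∣ contMat ((doubling s).take j) 0 0 := by
  have hlow : ∀ j < s.length, ¬ P ∣ contMat ((doubling s).take j) 0 0 := by
    intro j hj
    have heq : (doubling s).take j = s.take j := by
      obtain ⟨l, e, rfl⟩ := (List.eq_nil_or_concat' s).resolve_left hs
      rw [List.length_append, List.length_singleton] at hj
      rw [doubling, complementLast_concat, List.append_assoc,
        List.take_append_of_le_length (by omega), List.take_append_of_le_length (by omega)]
    rw [heq]
    exact h j hj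
  intro j hj hdvd
  have hlen := length_doubling s
  rcases lt_or_ge j s.length with hjs | hjs
  · exact hlow j hjs hdvd
  · set D := doubling s with hD
    have hdec : D = D.take j ++ D[j] :: D.drop (j + 1) := by
      rw [List.cons_getElem_drop_succ, List.take_append_drop]
    have hq : contMat (D.drop (j + 1)) 0 0 = contMat (D.take (D.length - (j + 1))) 0 0 := by
      rw [← contMat_reverse_zero_zero, List.reverse_drop, hD, reverse_doubling]
    have hK : contMat D 0 0 = contMat (D.take j) 0 0 * contMat (D[j] :: D.drop (j + 1)) 0 0
        + contMat (D.take j) 0 1 * contMat (D.drop (j + 1)) 0 0 := by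
      conv_lhs => rw [hdec, contMat_append, Matrix.mul_apply, Fin.sum_univ_two,
        contMat_cons_one_zero]
    have hPD : P ∣ contMat D 0 0 := by
      rw [hD, contMat_doubling hs]
      exact dvd_pow hPs two_ne_zero
    rw [hK, dvd_add_right (hdvd.mul_right _)] at hPD
    rcases hP.dvd_or_dvd hPD with h1 | h1
    · refine hP.not_isUnit (isUnit_of_dvd_one ?_)
      rw [← contMat_det_eq (D.take j)]
      exact dvd_add (hdvd.mul_right _) (h1.mul_right _)
    · rw [hq] at h1
      exact hlow _ (by omega) h1

theorem iterate_doubling_properties {s : List (ZMod 2)} (hs : Irreducible (contMat s 0 0))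
    (n : ℕ) : contMat (doubling^[n] s) 0 0 = contMat s 0 0 ^ 2 ^ n ∧
      ∀ j < (doubling^[n] s).length, ¬ contMat s 0 0 ∣ contMat ((doubling^[n] s).take j) 0 0 := by
  have hne : s ≠ [] := by
    rintro rfl
    exact hs.not_isUnit (by simp [contMat_nil])
  induction n with
  | zero =>
    refine ⟨by simp, fun j hj hdvd => ?_⟩
    rw [Function.iterate_zero, id] at hj hdvd
    obtain ⟨hm, hd, -⟩ := contMat_monic_and_degree (s.take j)
    have h0 := eq_zero_of_dvd_of_degree_lt hdvd (by
      rw [hd, (contMat_monic_and_degree s).2.1, List.length_take]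
      exact_mod_cast (by omega))
    exact hm.ne_zero h0
  | succ n ih =>
    have hne' : doubling^[n] s ≠ [] := by
      rw [← List.length_pos_iff, length_iterate_doubling]
      exact Nat.mul_pos (List.length_pos_iff.2 hne) (by positivity)
    rw [Function.iterate_succ_apply']
    refine ⟨by rw [contMat_doubling hne', ih.1, ← pow_mul, pow_succ], ?_⟩
    refine not_dvd_contMat_take_doubling hs.prime hne' ?_ ih.2
    rw [ih.1]
    exact dvd_pow_self _ (by positivity)

/-! ### The shift operator on sequences -/

/-- The shift operator on binary sequences. -/
def shift : Module.End (ZMod 2) (ℕ → ZMod 2) := LinearMap.funLeft (ZMod 2) (ZMod 2) Nat.succ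

theorem shift_pow_apply (n : ℕ) (a : ℕ → ZMod 2) (t : ℕ) : (shift ^ n) a t = a (t + n) := by
  induction n generalizing t with
  | zero => rfl
  | succ n ih =>
    rw [pow_succ', Module.End.mul_apply]
    change (shift ^ n) a (t + 1) = _
    rw [ih]
    congr 1
    ring

theorem aeval_pow_shift_apply (f : (ZMod 2)[X]) (m : ℕ) (a : ℕ → ZMod 2) (t : ℕ) :
    aeval (shift ^ m) f a t = f.sum fun i c => c * a (t + m * i) := by
  rw [aeval_def, eval₂_eq_sum, Polynomial.sum, Polynomial.sum, LinearMap.sum_apply,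
    Finset.sum_apply]
  refine Finset.sum_congr rfl fun i _ => ?_
  rw [Module.End.mul_apply, ← pow_mul, Module.algebraMap_end_apply, Pi.smul_apply, shift_pow_apply,
    smul_eq_mul]

theorem aeval_shift_apply (f : (ZMod 2)[X]) (a : ℕ → ZMod 2) (t : ℕ) :
    aeval shift f a t = f.sum fun i c => c * a (t + i) := by
  have h := aeval_pow_shift_apply f 1 a t
  simpa only [pow_one, one_mul] using h

/-- Reducing `X ^ t` modulo `f` expresses the term at `t` through the initial ones. -/
theorem eq_zero_of_aeval_shift_eq_zero {f : (ZMod 2)[X]} (hf : f.Monic) {a : ℕ → ZMod 2}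
    (ha : aeval shift f a = 0) (h0 : ∀ t < f.natDegree, a t = 0) : a = 0 := by
  funext t
  have h1 : (shift ^ t) a = aeval shift (X ^ t %ₘ f) a := by
    have h := congrArg (fun g => aeval shift g a) (modByMonic_add_div (X ^ t) f)
    simp only [map_add, mul_comm f, map_mul, LinearMap.add_apply, Module.End.mul_apply, ha,
      map_zero, add_zero, map_pow, aeval_X] at h
    exact h.symm
  have h2 := congrFun h1 0
  rw [shift_pow_apply, zero_add, aeval_shift_apply] at h2
  rw [h2]
  refine Finset.sum_eq_zero fun i hi => ?_
  beta_reduce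
  rw [zero_add, h0 i, mul_zero]
  by_contra hlt
  have hd : (X ^ t %ₘ f).degree < f.natDegree := by
    rw [← degree_eq_natDegree hf.ne_zero]
    exact degree_modByMonic_lt _ hf
  exact mem_support_iff.1 hi
    (coeff_eq_zero_of_degree_lt (hd.trans_le (by exact_mod_cast not_lt.1 hlt)))

theorem aeval_apply_of_intertwine {K V W : Type*} [Field K] [AddCommGroup V] [Module K V]
    [AddCommGroup W] [Module K W] {A : Module.End K V} {S : Module.End K W} (Φ : V →ₗ[K] W)
    (h : ∀ v, S (Φ v) = Φ (A v)) (f : K[X]) (v : V) : aeval S f (Φ v) = Φ (aeval A f v) := by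
  have hp : ∀ n v, (S ^ n) (Φ v) = Φ ((A ^ n) v) := by
    intro n
    induction n with
    | zero => simp
    | succ n ih => intro v; rw [pow_succ, Module.End.mul_apply, h, ih, pow_succ,
        Module.End.mul_apply]
  induction f using Polynomial.induction_on' with
  | add p q hp hq => simp [hp, hq]
  | monomial n c => simp [aeval_monomial, hp]

/-! ### Output sequences of the cells -/

/-- The transition map of an automaton as a linear map. -/
def caLin (s : List (ZMod 2)) : Module.End (ZMod 2) (Fin s.length → ZMod 2) :=
  Matrix.toLin' (caMatrix s)

theorem caLin_apply (s : List (ZMod 2)) (x : Fin s.length → ZMod 2) :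
    caLin s x = caStep s x := by
  rw [caLin, Matrix.toLin'_apply, caMatrix_mulVec]

theorem caLin_pow_apply (s : List (ZMod 2)) (t : ℕ) (x : Fin s.length → ZMod 2) :
    (caLin s ^ t) x = (caStep s)^[t] x := by
  rw [Module.End.pow_apply]
  congr 2
  exact funext (caLin_apply s)

theorem aeval_caLin_contMat (s : List (ZMod 2)) : aeval (caLin s) (contMat s 0 0) = 0 := by
  rw [← charpoly_caMatrix, caLin, ← Matrix.charpoly_toLin', LinearMap.aeval_self_charpoly]

/-- The state of the `j`-th cell is read off the first cell by a continuant in the transition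
map. -/
theorem aeval_caLin_contMat_take (s : List (ZMod 2)) (hs : 0 < s.length) (j : ℕ)
    (hj : j < s.length) (x : Fin s.length → ZMod 2) :
    aeval (caLin s) (contMat (s.take j) 0 0) x ⟨0, hs⟩ = x ⟨j, hj⟩ ∧
    aeval (caLin s) (contMat (s.take j) 0 1) x ⟨0, hs⟩
      = if 0 < j then x ⟨j - 1, by omega⟩ else 0 := by
  induction j generalizing x with
  | zero => simp [contMat_nil]
  | succ j ih =>
    have hj' : j < s.length := by omega
    rw [← List.take_append_getElem hj', contMat_concat_zero_zero, contMat_concat_zero_one]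
    refine ⟨?_, by simpa using (ih hj' x).1⟩
    rw [map_add, map_mul, map_add, aeval_X, aeval_C, LinearMap.add_apply, Pi.add_apply,
      Module.End.mul_apply, (ih hj' _).1, (ih hj' x).2, LinearMap.add_apply, Pi.add_apply,
      caLin_apply, Module.algebraMap_end_apply, caStep]
    have hsj : (if s.get ⟨j, hj'⟩ = 1 then x ⟨j, hj'⟩ else 0) = s[j] * x ⟨j, hj'⟩ := by
      rw [List.get_eq_getElem]
      generalize s[j] = e
      generalize x ⟨j, hj'⟩ = y
      revert e y
      decide
    rw [hsj, dif_pos hj, Pi.smul_apply, smul_eq_mul]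
    simp only
    generalize (if 0 < j then x ⟨j - 1, _⟩ else 0) = u
    linear_combination CharTwo.two_eq_zero (R := ZMod 2) * (u + s[j] * x ⟨j, hj'⟩)

/-- If the continuant of the cells to the left of the cell `k` is coprime to the characteristic
polynomial, the cell `k` produces every sequence satisfying the linear recurrence of the
characteristic polynomial. -/
theorem exists_initial_state (s : List (ZMod 2)) (k : Fin s.length)
    (hk : IsCoprime (contMat (s.take k) 0 0) (contMat s 0 0)) (c : ℕ → ZMod 2)
    (hc : aeval shift (contMat s 0 0) c = 0) :
    ∃ x, ∀ t, (caStep s)^[t] x k = c t := by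
  have hs : 0 < s.length := k.pos
  obtain ⟨hm, hd, -⟩ := contMat_monic_and_degree s
  have hnd : (contMat s 0 0).natDegree = s.length := natDegree_eq_of_degree_eq_some hd
  let Φ : (Fin s.length → ZMod 2) →ₗ[ZMod 2] (ℕ → ZMod 2) :=
    LinearMap.pi fun t => LinearMap.proj k ∘ₗ (caLin s ^ t)
  have hΦ : ∀ x t, Φ x t = (caLin s ^ t) x k := fun x t => rfl
  have hint : ∀ x, shift (Φ x) = Φ (caLin s x) := by
    intro x
    funext t
    change Φ x (t + 1) = _
    rw [hΦ, hΦ, pow_succ, Module.End.mul_apply]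
  have hrec : ∀ x, aeval shift (contMat s 0 0) (Φ x) = 0 := by
    intro x
    rw [aeval_apply_of_intertwine Φ hint, aeval_caLin_contMat, LinearMap.zero_apply, map_zero]
  have hinj : ∀ x, Φ x = 0 → x = 0 := by
    intro x hx
    obtain ⟨u, v, huv⟩ := hk
    -- With `u` inverting the prefix continuant, the first cell of `f(A) x` is cell `k` of `(u f)(A)
    -- x`, a combination of outputs of cell `k`.
    have hkey : ∀ f : (ZMod 2)[X], aeval (caLin s) f x ⟨0, hs⟩ = 0 := by
      intro f
      have h1 : aeval (caLin s) f x
          = aeval (caLin s) (contMat (s.take k) 0 0) (aeval (caLin s) (u * f) x) := by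
        have h2 := congrArg (fun g => aeval (caLin s) (g * f) x) huv
        simp only [add_mul, map_add, one_mul, LinearMap.add_apply] at h2
        rw [mul_right_comm v, mul_comm _ (contMat s 0 0), map_mul _ (contMat s 0 0),
          Module.End.mul_apply, aeval_caLin_contMat, LinearMap.zero_apply, add_zero,
          mul_right_comm u, mul_comm _ (contMat _ 0 0), map_mul, Module.End.mul_apply] at h2
        exact h2.symm
      rw [h1, (aeval_caLin_contMat_take s hs k k.2 _).1]
      have h3 := aeval_apply_of_intertwine Φ hint (u * f) x
      rw [hx, map_zero] at h3
      exact (congrFun h3 0).symm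
    funext j
    rw [← (aeval_caLin_contMat_take s hs j j.2 x).1, hkey, Pi.zero_apply]
  -- Keeping only the first `s.length` outputs gives an injective endomorphism of a
  -- finite-dimensional space, hence a surjective one.
  let Ψ : (Fin s.length → ZMod 2) →ₗ[ZMod 2] (Fin s.length → ZMod 2) :=
    LinearMap.funLeft (ZMod 2) (ZMod 2) (fun i : Fin s.length => (i : ℕ)) ∘ₗ Φ
  have hΨ : ∀ x i, Ψ x i = Φ x i := fun x i => rfl
  have hΨinj : Function.Injective Ψ := by
    rw [← LinearMap.ker_eq_bot, LinearMap.ker_eq_bot']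
    intro x hx
    refine hinj x (eq_zero_of_aeval_shift_eq_zero hm (hrec x) fun t ht => ?_)
    exact congrFun hx ⟨t, hnd ▸ ht⟩
  obtain ⟨x, hx⟩ := LinearMap.injective_iff_surjective.1 hΨinj (fun i => c i)
  refine ⟨x, fun t => ?_⟩
  have h0 : Φ x - c = 0 := by
    refine eq_zero_of_aeval_shift_eq_zero hm (by rw [map_sub, hrec, hc, sub_zero]) fun t ht => ?_
    have h1 := congrFun hx ⟨t, hnd ▸ ht⟩
    rw [hΨ] at h1
    rw [Pi.sub_apply, h1, sub_self]
  rw [← caLin_pow_apply, ← hΦ, sub_eq_zero.1 h0]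

/-! ### Decimation of recurrent sequences -/

theorem LinearRecurrence.IsSolution.aeval_shift {R : LinearRecurrence (ZMod 2)} {a : ℕ → ZMod 2}
    (ha : R.IsSolution a) : aeval shift R.charPoly a = 0 := by
  funext t
  rw [LinearRecurrence.charPoly, map_sub, map_sum, LinearMap.sub_apply, Pi.sub_apply,
    LinearMap.sum_apply, Finset.sum_apply, Pi.zero_apply, sub_eq_zero]
  simp only [aeval_monomial, Module.End.mul_apply, Module.algebraMap_end_apply, Pi.smul_apply,
    shift_pow_apply, smul_eq_mul, one_mul]
  exact ha t

theorem expand_two_pow (m : ℕ) (P : (ZMod 2)[X]) : expand (ZMod 2) (2 ^ m) P = P ^ 2 ^ m := by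
  induction m with
  | zero => simp
  | succ m ih => rw [pow_succ', ← expand_expand, ih, ZMod.expand_card, ← pow_mul, mul_comm]

theorem aeval_shift_comp_eq_zero {P Q : (ZMod 2)[X]} {M m : ℕ} (hdvd : Q ∣ expand (ZMod 2) M P)
    {b : ℕ → ZMod 2} (hb : aeval shift Q b = 0) {τ : ℕ → ℕ}
    (hτ : ∀ j, τ (j + 2 ^ m) = τ j + M) :
    aeval shift (P ^ 2 ^ m) (fun j => b (τ j)) = 0 := by
  have hτ' : ∀ i j, τ (j + 2 ^ m * i) = τ j + M * i := by
    intro i j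
    induction i with
    | zero => simp
    | succ i ih => rw [mul_add_one, ← add_assoc, hτ, ih, mul_add_one, add_assoc]
  have hb' : aeval shift (expand (ZMod 2) M P) b = 0 := by
    obtain ⟨w, hw⟩ := hdvd
    rw [hw, mul_comm, map_mul, Module.End.mul_apply, hb, map_zero]
  funext t
  rw [← expand_two_pow, expand_aeval, aeval_pow_shift_apply]
  have h := congrFun hb' (τ t)
  rw [expand_aeval, aeval_pow_shift_apply] at h
  simp only [hτ', h, Pi.zero_apply]

/-! ### PN-sequences -/

theorem LinearRecurrence.natDegree_charPoly (R : LinearRecurrence (ZMod 2)) :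
    R.charPoly.natDegree = R.order :=
  natDegree_eq_of_degree_eq_some R.charPoly_degree_eq_order

theorem IsMaximalLength.order_pos {R : LinearRecurrence (ZMod 2)} (h : IsMaximalLength R) :
    0 < R.order := by
  rw [← R.natDegree_charPoly]
  exact h.1.natDegree_pos

theorem IsMaximalLength.dvd_iff {R : LinearRecurrence (ZMod 2)} (h : IsMaximalLength R) (d : ℕ) :
    R.charPoly ∣ X ^ d - 1 ↔ 2 ^ R.order - 1 ∣ d := by
  rw [← h.2, orderOf_dvd_iff_pow_eq_one, ← AdjoinRoot.mk_eq_zero, map_sub, map_pow,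
    AdjoinRoot.mk_X, map_one, sub_eq_zero]

section PN

variable {R : LinearRecurrence (ZMod 2)} {a : ℕ → ZMod 2}

theorem IsMaximalLength.periodic (h : IsMaximalLength R) (ha : R.IsSolution a) :
    Function.Periodic a (2 ^ R.order - 1) := by
  intro t
  obtain ⟨w, hw⟩ := (h.dvd_iff (2 ^ R.order - 1)).2 dvd_rfl
  have h1 : aeval shift (X ^ (2 ^ R.order - 1) - 1 : (ZMod 2)[X]) a = 0 := by
    rw [hw, mul_comm, map_mul, Module.End.mul_apply, ha.aeval_shift, map_zero]
  rw [map_sub, map_pow, aeval_X, map_one, LinearMap.sub_apply, Module.End.one_apply] at h1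
  rw [← shift_pow_apply _ a t, sub_eq_zero.1 h1]

theorem IsMaximalLength.shift_pow_ne_zero (h : IsMaximalLength R) (ha : R.IsSolution a)
    (ha0 : a ≠ 0) (t : ℕ) : (shift ^ t) a ≠ 0 := by
  intro h0
  apply ha0
  funext k
  have hT : 1 ≤ 2 ^ R.order - 1 := Nat.le_sub_one_of_lt (Nat.one_lt_two_pow h.order_pos.ne')
  have h1 := (h.periodic ha).nat_mul t k
  rw [← h1]
  have h2 := congrFun h0 (k + (t * (2 ^ R.order - 1) - t))
  rw [shift_pow_apply, add_assoc, Nat.sub_add_cancel (Nat.le_mul_of_pos_right t hT)] at h2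
  exact h2

theorem LinearRecurrence.IsSolution.aeval_shift_pow (ha : R.IsSolution a) (t : ℕ) :
    aeval shift R.charPoly ((shift ^ t) a) = 0 := by
  have h : aeval shift (R.charPoly * X ^ t) a = aeval shift (X ^ t * R.charPoly) a := by
    rw [mul_comm]
  rwa [map_mul, map_mul, Module.End.mul_apply, Module.End.mul_apply, ha.aeval_shift, map_zero,
    map_pow, aeval_X] at h

/-- The states of a maximal-length register within one period are distinct. -/
theorem IsMaximalLength.state_injOn (h : IsMaximalLength R) (ha : R.IsSolution a) (ha0 : a ≠ 0) :
    Set.InjOn (fun t (i : Fin R.order) => a (t + i)) (Finset.range (2 ^ R.order - 1)) := by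
  have key : ∀ t t', t < t' → t' < 2 ^ R.order - 1 →
      (fun i : Fin R.order => a (t + i)) ≠ fun i : Fin R.order => a (t' + i) := by
    intro t t' htt' ht' heq
    have h1 : (shift ^ t) a - (shift ^ t') a = 0 := by
      refine eq_zero_of_aeval_shift_eq_zero R.charPoly_monic ?_ fun i hi => ?_
      · rw [map_sub, ha.aeval_shift_pow, ha.aeval_shift_pow, sub_zero]
      · rw [R.natDegree_charPoly] at hi
        have h2 := congrFun heq ⟨i, hi⟩
        simp only at h2
        rw [Pi.sub_apply, shift_pow_apply, shift_pow_apply, add_comm i, add_comm i, h2, sub_self]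
    have h2 : aeval shift (X ^ (t' - t) - 1 : (ZMod 2)[X]) ((shift ^ t) a) = 0 := by
      rw [map_sub, map_pow, aeval_X, map_one, LinearMap.sub_apply, Module.End.one_apply,
        ← Module.End.mul_apply, ← pow_add, Nat.sub_add_cancel htt'.le, ← neg_sub, h1, neg_zero]
    -- By primitivity the two annihilators of the shifted sequence are coprime, which would make it
    -- zero.
    have h3 : ¬ R.charPoly ∣ X ^ (t' - t) - 1 := by
      rw [h.dvd_iff]
      intro hd
      have := Nat.le_of_dvd (by omega) hd
      omega
    obtain ⟨u, v, huv⟩ := (h.1.coprime_iff_not_dvd).2 h3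
    apply h.shift_pow_ne_zero ha ha0 t
    have h4 := congrArg (fun g => aeval shift g ((shift ^ t) a)) huv
    simp only [map_add, map_mul, LinearMap.add_apply, Module.End.mul_apply, ha.aeval_shift_pow, h2,
      map_zero, add_zero, map_one, Module.End.one_apply] at h4
    exact h4.symm
  intro t ht t' ht' heq
  simp only [Finset.coe_range, Set.mem_Iio] at ht ht'
  rcases lt_trichotomy t t' with hlt | heq' | hlt
  · exact absurd heq (key t t' hlt ht')
  · exact heq'
  · exact absurd heq.symm (key t' t hlt ht)

/-- There are `2 ^ L - 1` distinct nonzero states, so all nonzero vectors occur. -/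
theorem IsMaximalLength.image_state (h : IsMaximalLength R) (ha : R.IsSolution a) (ha0 : a ≠ 0) :
    (Finset.range (2 ^ R.order - 1)).image (fun t (i : Fin R.order) => a (t + i))
      = Finset.univ.erase 0 := by
  refine Finset.eq_of_subset_of_card_le ?_ ?_
  · intro v hv
    obtain ⟨t, -, rfl⟩ := Finset.mem_image.1 hv
    refine Finset.mem_erase.2 ⟨fun h0 => ?_, Finset.mem_univ _⟩
    refine h.shift_pow_ne_zero ha ha0 t
      (eq_zero_of_aeval_shift_eq_zero R.charPoly_monic (ha.aeval_shift_pow t) fun i hi => ?_)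
    rw [R.natDegree_charPoly] at hi
    rw [shift_pow_apply, add_comm]
    exact congrFun h0 ⟨i, hi⟩
  · rw [Finset.card_image_of_injOn (h.state_injOn ha ha0), Finset.card_range,
      Finset.card_erase_of_mem (Finset.mem_univ _), Finset.card_univ]
    simp [ZMod.card]

theorem card_filter_apply_zero_eq_one {n : ℕ} (hn : 0 < n) :
    ((Finset.univ : Finset (Fin n → ZMod 2)).filter fun v => v ⟨0, hn⟩ = 1).card
      = 2 ^ (n - 1) := by
  obtain ⟨n, rfl⟩ := Nat.exists_eq_succ_of_ne_zero hn.ne'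
  have h : ((Finset.univ : Finset (Fin (n + 1) → ZMod 2)).filter fun v => v 0 = 1)
      = Fintype.piFinset fun i => if i = 0 then {1} else Finset.univ := by
    ext v
    simp only [Finset.mem_filter, Finset.mem_univ, true_and, Fintype.mem_piFinset]
    constructor
    · intro hv i
      split_ifs with hi
      · simp [hi, hv]
      · simp
    · intro hv
      simpa using hv 0
  change (Finset.univ.filter fun v : Fin (n + 1) → ZMod 2 => v 0 = 1).card = _
  rw [h, Fintype.card_piFinset, Fin.prod_univ_succ]
  simp [Fin.succ_ne_zero, ZMod.card]

/-- A PN-sequence has `2 ^ (L - 1)` ones in each period. -/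
theorem IsMaximalLength.card_filter (h : IsMaximalLength R) (ha : R.IsSolution a) (ha0 : a ≠ 0) :
    ((Finset.range (2 ^ R.order - 1)).filter fun t => a t = 1).card = 2 ^ (R.order - 1) := by
  rw [← card_filter_apply_zero_eq_one h.order_pos,
    ← Finset.card_image_of_injOn (s := (Finset.range (2 ^ R.order - 1)).filter fun t => a t = 1)
      (f := fun t (i : Fin R.order) => a (t + i))
      ((h.state_injOn ha ha0).mono (Finset.coe_subset.2 (Finset.filter_subset _ _)))]
  congr 1
  have himg := h.image_state ha ha0
  ext v
  constructor
  · intro hv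
    obtain ⟨t, ht, rfl⟩ := Finset.mem_image.1 hv
    simpa using (Finset.mem_filter.1 ht).2
  · intro hv
    have hv1 := (Finset.mem_filter.1 hv).2
    have hv2 : v ∈ (Finset.univ.erase 0 : Finset (Fin R.order → ZMod 2)) := by
      refine Finset.mem_erase.2 ⟨?_, Finset.mem_univ _⟩
      rintro rfl
      exact zero_ne_one hv1
    rw [← himg] at hv2
    obtain ⟨t, ht, rfl⟩ := Finset.mem_image.1 hv2
    exact Finset.mem_image.2 ⟨t, Finset.mem_filter.2 ⟨ht, by simpa using hv1⟩, rfl⟩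

theorem IsMaximalLength.card_filter_Ico (h : IsMaximalLength R) (ha : R.IsSolution a)
    (ha0 : a ≠ 0) (k : ℕ) :
    ((Finset.Ico k (k + (2 ^ R.order - 1))).filter fun t => a t = 1).card
      = 2 ^ (R.order - 1) := by
  rw [Nat.filter_Ico_card_eq_of_periodic, Nat.count_eq_card_filter_range, h.card_filter ha ha0]
  intro t
  simp only [h.periodic ha t]

theorem IsMaximalLength.sum_val (h : IsMaximalLength R) (ha : R.IsSolution a) (ha0 : a ≠ 0)
    (k : ℕ) : ∑ u ∈ Finset.range (2 ^ R.order - 1), (a (k + u)).val = 2 ^ (R.order - 1) := by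
  rw [← h.card_filter_Ico ha ha0 k, Finset.card_filter, Finset.sum_Ico_eq_sum_range,
    Nat.add_sub_cancel_left]
  refine Finset.sum_congr rfl fun u _ => ?_
  generalize a (k + u) = e
  revert e
  decide

/-- Every period contains `2 ^ (L - 1)` ones, so skipping that many ones advances by one period. -/
theorem IsMaximalLength.nth_add (h : IsMaximalLength R) (ha : R.IsSolution a) (ha0 : a ≠ 0)
    (j : ℕ) : Nat.nth (fun i => a i = 1) (j + 2 ^ (R.order - 1))
      = Nat.nth (fun i => a i = 1) j + (2 ^ R.order - 1) := by
  have hinf : {i | a i = 1}.Infinite := by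
    refine Set.infinite_of_not_bddAbove ?_
    rintro ⟨B, hB⟩
    have hpos : 0 < ((Finset.Ico (B + 1) (B + 1 + (2 ^ R.order - 1))).filter
        fun t => a t = 1).card := by
      rw [h.card_filter_Ico ha ha0]
      positivity
    obtain ⟨t, ht⟩ := Finset.card_pos.1 hpos
    obtain ⟨ht1, ht2⟩ := Finset.mem_filter.1 ht
    have h1 := hB ht2
    have h2 := (Finset.mem_Ico.1 ht1).1
    omega
  have hj := Nat.nth_mem_of_infinite hinf j
  have hj' : a (Nat.nth (fun i => a i = 1) j + (2 ^ R.order - 1)) = 1 := by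
    rw [h.periodic ha]
    exact hj
  have hcount : Nat.count (fun i => a i = 1) (Nat.nth (fun i => a i = 1) j + (2 ^ R.order - 1))
      = j + 2 ^ (R.order - 1) := by
    have h1 : Nat.count (fun i => a i = 1) (2 ^ R.order - 1) = 2 ^ (R.order - 1) := by
      rw [Nat.count_eq_card_filter_range, h.card_filter ha ha0]
    have h2 : (fun k => a (2 ^ R.order - 1 + k) = 1) = fun k => a k = 1 := by
      funext k
      rw [add_comm, h.periodic ha]
    rw [add_comm, Nat.count_add, h1]
    simp only [h2]
    rw [Nat.count_nth_of_infinite hinf, add_comm]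
  rw [← hcount]
  exact Nat.nth_count (p := fun i => a i = 1) hj'

/-- Over a period the constant `1` contributes `2 ^ L - 1` and cell `i j` contributes `2 ^ j * 2 ^
(L - 1)`, whichever cell it is. -/
theorem IsMaximalLength.sum_decimation_add (h : IsMaximalLength R) (ha : R.IsSolution a)
    (ha0 : a ≠ 0) {w : ℕ} (i : Fin w → Fin R.order) (t : ℕ) :
    ∑ u ∈ Finset.range (t + (2 ^ R.order - 1)), decimation a i u
      = ∑ u ∈ Finset.range t, decimation a i u + ((1 + 2 ^ w) * 2 ^ (R.order - 1) - 1) := by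
  rw [Finset.sum_range_add]
  congr 1
  simp only [decimation]
  rw [Finset.sum_add_distrib, Finset.sum_comm]
  have hj : ∀ j : Fin w, ∑ u ∈ Finset.range (2 ^ R.order - 1),
      2 ^ (j : ℕ) * (a (t + u + (i j : ℕ))).val = 2 ^ (j : ℕ) * 2 ^ (R.order - 1) := by
    intro j
    rw [← Finset.mul_sum, ← h.sum_val ha ha0 (t + i j)]
    simp only [add_right_comm]
  have hg : ∑ j : Fin w, 2 ^ (j : ℕ) = 2 ^ w - 1 := by
    rw [Fin.sum_univ_eq_sum_range fun j => 2 ^ j]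
    simpa using Nat.geomSum_eq le_rfl w
  rw [Finset.sum_congr rfl fun j _ => hj j, ← Finset.sum_mul, hg, Finset.sum_const,
    Finset.card_range, smul_eq_mul, mul_one]
  have h1 : 2 ^ R.order = 2 * 2 ^ (R.order - 1) := by
    rw [← pow_succ', Nat.sub_add_cancel h.order_pos]
  have h2 : 1 ≤ 2 ^ (R.order - 1) := Nat.one_le_two_pow
  have h3 : 1 ≤ 2 ^ w := Nat.one_le_two_pow
  obtain ⟨x, hx⟩ := Nat.exists_eq_add_of_le h2
  obtain ⟨y, hy⟩ := Nat.exists_eq_add_of_le h3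
  rw [h1, hx, hy, Nat.add_sub_cancel_left]
  have h4 : (1 + (1 + y)) * (1 + x) = 2 * (1 + x) + y * (1 + x) := by ring
  omega

/-- Both generators read off the second sequence at positions `τ` with
`τ (j + 2 ^ (L₁ - 1)) = τ j + M`. -/
theorem IsMaximalLength.exists_positions (h : IsMaximalLength R) (ha : R.IsSolution a)
    (ha0 : a ≠ 0) {b c : ℕ → ZMod 2} {M : ℕ}
    (hMc : (M = ∑ j ∈ Finset.range R.order, 2 ^ j ∧ c = shrunken a b) ∨
      ∃ (w : ℕ) (i : Fin w → Fin R.order),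
        M = (1 + 2 ^ w) * 2 ^ (R.order - 1) - 1 ∧ c = ccsg a b i) :
    ∃ τ : ℕ → ℕ, c = (fun j => b (τ j)) ∧ ∀ j, τ (j + 2 ^ (R.order - 1)) = τ j + M := by
  rcases hMc with ⟨rfl, rfl⟩ | ⟨w, i, rfl, rfl⟩
  · refine ⟨_, rfl, fun j => ?_⟩
    rw [h.nth_add ha ha0]
    congr 1
    simpa using (Nat.geomSum_eq (m := 2) le_rfl R.order).symm
  · refine ⟨fun j => ∑ u ∈ Finset.range (Nat.nth (fun i => a i = 1) j), decimation a i u, rfl,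
      fun j => ?_⟩
    beta_reduce
    rw [h.nth_add ha ha0, h.sum_decimation_add ha ha0]

end PN

/-! ### The polynomial of the generator -/

section GeneratorPolynomial

variable {R : LinearRecurrence (ZMod 2)} {K : Type*} [Field K] [Algebra (ZMod 2) K] {α : K}

theorem IsMaximalLength.pow_eq_one (h : IsMaximalLength R) (hα : aeval α R.charPoly = 0) :
    α ^ (2 ^ R.order - 1) = 1 := by
  obtain ⟨w, hw⟩ := (h.dvd_iff (2 ^ R.order - 1)).2 dvd_rfl
  have h1 := congrArg (aeval α) hw
  rw [map_mul, hα, zero_mul, map_sub, map_pow, aeval_X, map_one] at h1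
  exact sub_eq_zero.1 h1

/-- Frobenius permutes the factors cyclically, so each coefficient satisfies `x ^ 2 = x`. -/
theorem exists_map_eq_prod {γ : K} {n : ℕ} (hγ : γ ^ 2 ^ n = γ) :
    ∃ P : (ZMod 2)[X],
      P.map (algebraMap (ZMod 2) K) = ∏ i ∈ Finset.range n, (X + C (γ ^ 2 ^ i)) := by
  have : CharP K 2 := charP_of_injective_algebraMap (algebraMap (ZMod 2) K).injective 2
  set Q := ∏ i ∈ Finset.range n, (X + C (γ ^ 2 ^ i)) with hQ
  have hfrob : Q.map (frobenius K 2) = Q := by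
    have h1 : Q.map (frobenius K 2) = ∏ i ∈ Finset.range n, (X + C (γ ^ 2 ^ (i + 1))) := by
      rw [hQ, Polynomial.map_prod]
      refine Finset.prod_congr rfl fun i _ => ?_
      rw [Polynomial.map_add, map_X, map_C, frobenius_def, ← pow_mul, ← pow_succ]
    have h2 := Finset.prod_range_succ (fun i => X + C (γ ^ 2 ^ i)) n
    rw [Finset.prod_range_succ', hγ, pow_zero, pow_one] at h2
    rw [h1]
    exact mul_right_cancel₀ (monic_X_add_C γ).ne_zero h2
  have hl : Q ∈ lifts (algebraMap (ZMod 2) K) := by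
    rw [lifts_iff_coeff_lifts]
    intro k
    have h1 := congrArg (fun p => coeff p k) hfrob
    simp only [coeff_map, frobenius_def] at h1
    have h2 : Q.coeff k * (Q.coeff k - 1) = 0 := by linear_combination h1
    rcases mul_eq_zero.1 h2 with h3 | h3
    · exact ⟨0, by rw [h3, map_zero]⟩
    · exact ⟨1, by rw [sub_eq_zero.1 h3, map_one]⟩
  exact (mem_lifts _).1 hl

theorem natDegree_of_map_eq_prod {P : (ZMod 2)[X]} {n : ℕ} {f : ℕ → K}
    (hP : P.map (algebraMap (ZMod 2) K) = ∏ i ∈ Finset.range n, (X + C (f i))) :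
    P.natDegree = n := by
  rw [← natDegree_map (algebraMap (ZMod 2) K), hP,
    natDegree_prod_of_monic _ _ fun i _ => monic_X_add_C _]
  simp

theorem aeval_eq_zero_of_map_eq_prod {P : (ZMod 2)[X]} {n : ℕ} (hn : 0 < n) {γ : K}
    (hP : P.map (algebraMap (ZMod 2) K) = ∏ i ∈ Finset.range n, (X + C (γ ^ 2 ^ i))) :
    aeval γ P = 0 := by
  have : CharP K 2 := charP_of_injective_algebraMap (algebraMap (ZMod 2) K).injective 2
  rw [← eval_map_algebraMap, hP, eval_prod]
  exact Finset.prod_eq_zero (Finset.mem_range.2 hn) (by simp [CharTwo.add_self_eq_zero])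

theorem IsMaximalLength.minpoly_eq (h : IsMaximalLength R) (hα : aeval α R.charPoly = 0) :
    minpoly (ZMod 2) α = R.charPoly :=
  (minpoly.eq_of_irreducible_of_monic h.1 hα R.charPoly_monic).symm

open IntermediateField in
-- For such `M`, `α` is a power of `α ^ M`. Both generate the same field, so the minimal polynomial
-- of `α ^ M` has the degree of `P`.
theorem IsMaximalLength.irreducible_of_coprime (h : IsMaximalLength R)
    (hα : aeval α R.charPoly = 0) {M : ℕ} (hM : M.Coprime (2 ^ R.order - 1)) {P : (ZMod 2)[X]}
    (hd : P.natDegree = R.order) (hP : aeval (α ^ M) P = 0) : Irreducible P := by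
  have hP0 : P ≠ 0 := by
    rintro rfl
    rw [natDegree_zero] at hd
    exact h.order_pos.ne hd
  have hint : IsIntegral (ZMod 2) α := ⟨_, R.charPoly_monic, hα⟩
  have hint' : IsIntegral (ZMod 2) (α ^ M) := hint.pow M
  obtain ⟨k, hk⟩ := exists_pow_eq_self_of_coprime
    (hM.coprime_dvd_right (orderOf_dvd_of_pow_eq_one (h.pow_eq_one hα)))
  have hadj : (ZMod 2)⟮α ^ M⟯ = (ZMod 2)⟮α⟯ := by
    refine le_antisymm ?_ ?_
    · rw [adjoin_simple_le_iff]
      exact pow_mem (mem_adjoin_simple_self _ _) M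
    · rw [adjoin_simple_le_iff]
      nth_rw 2 [← hk]
      exact pow_mem (mem_adjoin_simple_self _ _) k
  have hdeg : (minpoly (ZMod 2) (α ^ M)).natDegree = R.order := by
    rw [← adjoin.finrank hint', hadj, adjoin.finrank hint, h.minpoly_eq hα, R.natDegree_charPoly]
  have heq : minpoly (ZMod 2) (α ^ M) = P := by
    refine (eq_of_monic_of_dvd_of_natDegree_le (minpoly.monic hint')
      (monic_of_ne_zero_zmod_two hP0) (minpoly.dvd _ _ hP) (by rw [hd, hdeg])).symm
  rw [← heq]
  exact minpoly.irreducible hint'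

theorem IsMaximalLength.dvd_expand (h : IsMaximalLength R) (hα : aeval α R.charPoly = 0) {M : ℕ}
    {P : (ZMod 2)[X]} (hP : aeval (α ^ M) P = 0) : R.charPoly ∣ expand (ZMod 2) M P := by
  rw [← h.minpoly_eq hα]
  exact minpoly.dvd _ _ (by rw [expand_aeval, hP])

end GeneratorPolynomial

/-! ### The main theorem. -/

theorem mainTheorem1
    (R₁ R₂ : LinearRecurrence (ZMod 2)) (h₁ : IsMaximalLength R₁) (h₂ : IsMaximalLength R₂)
    (a b : ℕ → ZMod 2) (ha : R₁.IsSolution a) (ha0 : a ≠ 0) (hb : R₂.IsSolution b)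
    {K : Type*} [Field K] [Algebra (ZMod 2) K] (α : K) (hα : aeval α R₂.charPoly = 0)
    (M : ℕ) (c : ℕ → ZMod 2)
    (hMc : (M = ∑ j ∈ Finset.range R₁.order, 2 ^ j ∧ c = shrunken a b) ∨
      ∃ (w : ℕ) (i : Fin w → Fin R₁.order),
        M = (1 + 2 ^ w) * 2 ^ (R₁.order - 1) - 1 ∧ c = ccsg a b i) :
    ∃ P : (ZMod 2)[X],
      P.map (algebraMap (ZMod 2) K) = ∏ i ∈ Finset.range R₂.order, (X + C (α ^ (2 ^ i * M))) ∧
      P.natDegree = R₂.order ∧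
      (M.Coprime (2 ^ R₂.order - 1) → Irreducible P) ∧
      (Irreducible P →
        ∃ s₁ s₂ : List (ZMod 2),
          IsCattellMuzioPair P s₁ s₂ ∧
          (2 ≤ R₂.order → s₁ ≠ s₂) ∧
          ∀ s : List (ZMod 2), s = s₁ ∨ s = s₂ →
            (doubling^[R₁.order - 1] s).length = R₂.order * 2 ^ (R₁.order - 1) ∧
            (caMatrix (doubling^[R₁.order - 1] s)).charpoly = P ^ 2 ^ (R₁.order - 1) ∧
            ∀ k : Fin (doubling^[R₁.order - 1] s).length,
              ∃ x : Fin (doubling^[R₁.order - 1] s).length → ZMod 2,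
                ∀ t : ℕ, (caStep (doubling^[R₁.order - 1] s))^[t] x k = c t) := by
  have hα1 := h₂.pow_eq_one hα
  have hγ : (α ^ M) ^ 2 ^ R₂.order = α ^ M := by
    have h1 : 2 ^ R₂.order = 2 ^ R₂.order - 1 + 1 := (Nat.sub_add_cancel Nat.one_le_two_pow).symm
    rw [h1, pow_succ, pow_right_comm, hα1, one_pow, one_mul]
  obtain ⟨P, hP⟩ := exists_map_eq_prod hγ
  have hdeg := natDegree_of_map_eq_prod hP
  have hroot := aeval_eq_zero_of_map_eq_prod h₂.order_pos hP
  refine ⟨P, ?_, hdeg, fun hM => h₂.irreducible_of_coprime hα hM hdeg hroot, fun hirr => ?_⟩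
  · rw [hP]
    refine Finset.prod_congr rfl fun i _ => ?_
    rw [← pow_mul, mul_comm]
  · obtain ⟨s₁, s₂, hpair, hne⟩ := exists_isCattellMuzioPair hirr
    refine ⟨s₁, s₂, hpair, by rwa [hdeg] at hne, fun s hs => ?_⟩
    have hsP : contMat s 0 0 = P := by
      rw [← charpoly_caMatrix]
      exact (hpair.1 s).2 hs
    obtain ⟨hK, hprefix⟩ := iterate_doubling_properties (hsP ▸ hirr) (R₁.order - 1)
    rw [hsP] at hK hprefix
    refine ⟨?_, by rw [charpoly_caMatrix, hK], fun k => ?_⟩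
    · rw [length_iterate_doubling, ← hdeg, ← hsP,
        natDegree_eq_of_degree_eq_some (contMat_monic_and_degree s).2.1]
    · refine exists_initial_state _ k ?_ c ?_
      · rw [hK]
        exact ((hirr.coprime_iff_not_dvd.2 (hprefix k k.2)).symm).pow_right
      · obtain ⟨τ, rfl, hτ⟩ := h₁.exists_positions ha ha0 hMc
        rw [hK]
        exact aeval_shift_comp_eq_zero (h₂.dvd_expand hα hroot) hb.aeval_shift hτ
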